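/- Let $A$ be a (not necessarily unital) simple $C^*$-algebra, i.e. $A\neq 0$ and $A$ has no closed two-sided ideals other than $0$ and $A$, and let $\gamma=(\gamma_t)_{t\in\mathbb R}$ be a continuous one-parameter group of $*$-automorphisms of $A$ (so $t\mapsto\gamma_t(a)$ is norm continuous for every $a\in A$). Let $D\subseteq A$ be an abelian $C^*$-subalgebra and let $P:A\to D$ be a conditional expectation, i.e. a positive contractive linear map which is the identity on $D$ and satisfies $P(da)=dP(a)$ and $P(ad)=P(a)d$ for all $a\in A$, $d\in D$. A weight on $A$ is a map $\omega:A_+\to[0,\infty]$ with $\omega(a+b)=\omega(a)+\omega(b)$ and $\omega(\lambda a)=\lambda\omega(a)$ for $a,b\in A_+$ and real $\lambda>0$. It is proper when it is non-zero, lower semi-continuous, and finite on a dense subset of $A_+$. For a proper weight put $\mathcal N_\omega=\{a\in A:\omega(a^*a)<\infty\}$ and $\mathcal M_\omega=\operatorname{span}\{a^*b: a,b\in\mathcal N_\omega\}$, and write $\omega$ also for the unique linear functional on $\mathcal M_\omega$ that extends $\omega|_{\mathcal M_\omega\cap A_+}$. For $\beta\in\mathbb R$, a $\beta$-KMS weight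 for $\gamma$ is a proper weight $\omega$ such that $\omega\circ\gamma_t=\omega$ for all $t\in\mathbb R$ and such that for all $a,b\in\mathcal N_\omega\cap\mathcal N_\omega^*$ there is a bounded continuous function $F$ on the closed strip of all $z\in\mathbb C$ whose imaginary part lies between $0$ and $\beta$, holomorphic in the interior of the strip, with $$F(t)=\omega(a\gamma_t(b)),\qquad F(t+i\beta)=\omega(\gamma_t(b)a)\qquad\text{for all } t\in\mathbb R.$$ Let $\beta\neq0$ and let $\omega$ be a $\beta$-KMS weight for $\gamma$ such that $\omega\circ P=\omega$ on $A_+$. Then $\omega$ is faithful (if $a\in A_+$ and $\omega(a)=0$ then $a=0$), and $\gamma_t(d)=d$ for all $t\in\mathbb R$ and all $d\in D$. -/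

import Mathlib

open scoped ENNReal

noncomputable section

namespace KMS

/-- A weight on a C⋆-algebra: a map from the positive cone to `[0, ∞]` that is additive and
positively homogeneous. -/
structure Weight (A : Type*) [NonUnitalCStarAlgebra A] [PartialOrder A] [StarOrderedRing A] where
  toFun : {a : A // 0 ≤ a} → ℝ≥0∞
  map_add' : ∀ a b : {a : A // 0 ≤ a},
    toFun ⟨(a : A) + b, add_nonneg a.2 b.2⟩ = toFun a + toFun b
  map_smul' : ∀ (c : ℝ) (hc : 0 < c) (a : {a : A // 0 ≤ a}),
    toFun ⟨c • (a : A), smul_nonneg hc.le a.2⟩ = ENNReal.ofReal c * toFun a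

variable {A : Type*} [NonUnitalCStarAlgebra A] [PartialOrder A] [StarOrderedRing A]

namespace Weight

instance : CoeFun (Weight A) (fun _ => {a : A // 0 ≤ a} → ℝ≥0∞) := ⟨Weight.toFun⟩

/-- Proper weights: nonzero, densely defined and lower semicontinuous. -/
structure IsProper (ψ : Weight A) : Prop where
  ne_zero : ∃ a, ψ a ≠ 0
  densely_defined : Dense {a : {a : A // 0 ≤ a} | ψ a < ∞}
  lsc : LowerSemicontinuous ψ.toFun

/-- Faithful weights. -/
def IsFaithful (ψ : Weight A) : Prop :=
  ∀ a : {a : A // 0 ≤ a}, ψ a = 0 → (a : A) = 0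

/-- The set `N_ψ` of all `a` with `ψ (a⋆ a) < ∞`. -/
def N (ψ : Weight A) : Set A :=
  {a | ψ ⟨star a * a, star_mul_self_nonneg a⟩ < ∞}

/-- The linear span `M_ψ` of the products `a⋆ b` with `a, b ∈ N_ψ`. -/
def M (ψ : Weight A) : Submodule ℂ A :=
  Submodule.span ℂ {x | ∃ a ∈ ψ.N, ∃ b ∈ ψ.N, x = star a * b}

/-! ### The linear extension of a weight to `M_ψ` -/

lemma map_add (ψ : Weight A) {a b : A} (ha : 0 ≤ a) (hb : 0 ≤ b) :
    ψ ⟨a + b, add_nonneg ha hb⟩ = ψ ⟨a, ha⟩ + ψ ⟨b, hb⟩ :=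
  ψ.map_add' ⟨a, ha⟩ ⟨b, hb⟩

lemma map_smul (ψ : Weight A) {c : ℝ} (hc : 0 < c) {a : A} (ha : 0 ≤ a) :
    ψ ⟨c • a, smul_nonneg hc.le ha⟩ = ENNReal.ofReal c * ψ ⟨a, ha⟩ :=
  ψ.map_smul' c hc ⟨a, ha⟩

lemma mono (ψ : Weight A) {a b : A} (ha : 0 ≤ a) (hb : 0 ≤ b) (h : a ≤ b) :
    ψ ⟨a, ha⟩ ≤ ψ ⟨b, hb⟩ := by
  have h2 := ψ.map_add ha (sub_nonneg.2 h)
  have h3 : (⟨a + (b - a), add_nonneg ha (sub_nonneg.2 h)⟩ : {a : A // 0 ≤ a}) = ⟨b, hb⟩ :=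
    Subtype.ext (by simp)
  rw [h3] at h2
  rw [h2]
  exact le_self_add

lemma map_zero_of_lt_top (ψ : Weight A) {a : A} (ha : 0 ≤ a) (h : ψ ⟨a, ha⟩ < ∞) :
    ψ ⟨0, le_rfl⟩ = 0 := by
  have h0 : ψ ⟨0, le_rfl⟩ < ∞ := (ψ.mono le_rfl ha ha).trans_lt h
  have h2 := ψ.map_add (le_refl (0 : A)) (le_refl (0 : A))
  have h3 : (⟨(0 : A) + 0, add_nonneg le_rfl le_rfl⟩ : {a : A // 0 ≤ a}) = ⟨0, le_rfl⟩ :=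
    Subtype.ext (by simp)
  rw [h3] at h2
  exact ((ENNReal.add_right_inj h0.ne).1 (by rw [add_zero]; exact h2)).symm

/-- The positive elements of finite weight. -/
def FiniteAt (ψ : Weight A) (p : A) : Prop := ∃ h : 0 ≤ p, ψ ⟨p, h⟩ < ∞

open Classical in
/-- The real number `ψ p` for a positive element `p` of finite weight. -/
def realVal (ψ : Weight A) (p : A) : ℝ := if h : 0 ≤ p then (ψ ⟨p, h⟩).toReal else 0

lemma FiniteAt.add {ψ : Weight A} {p q : A} (hp : ψ.FiniteAt p) (hq : ψ.FiniteAt q) : ψ.FiniteAt (p + q) := by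
  obtain ⟨hp, hp'⟩ := hp
  obtain ⟨hq, hq'⟩ := hq
  exact ⟨add_nonneg hp hq, by rw [ψ.map_add hp hq]; exact ENNReal.add_lt_top.2 ⟨hp', hq'⟩⟩

lemma realVal_add {ψ : Weight A} {p q : A} (hp : ψ.FiniteAt p) (hq : ψ.FiniteAt q) :
    ψ.realVal (p + q) = ψ.realVal p + ψ.realVal q := by
  obtain ⟨hp, hp'⟩ := hp
  obtain ⟨hq, hq'⟩ := hq
  rw [realVal, realVal, realVal, dif_pos hp, dif_pos hq, dif_pos (add_nonneg hp hq), ψ.map_add hp hq,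
    ENNReal.toReal_add hp'.ne hq'.ne]

lemma FiniteAt.zero {ψ : Weight A} {p : A} (hp : ψ.FiniteAt p) : ψ.FiniteAt 0 :=
  ⟨le_rfl, by rw [ψ.map_zero_of_lt_top hp.1 hp.2]; exact ENNReal.zero_lt_top⟩

lemma realVal_zero {ψ : Weight A} (h : ψ.FiniteAt 0) : ψ.realVal 0 = 0 := by
  rw [realVal, dif_pos le_rfl, ψ.map_zero_of_lt_top h.1 h.2, ENNReal.toReal_zero]

lemma FiniteAt.smul {ψ : Weight A} {p : A} (hp : ψ.FiniteAt p) {c : ℝ} (hc : 0 ≤ c) : ψ.FiniteAt (c • p) := by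
  rcases hc.eq_or_lt with rfl | hc
  · rw [zero_smul]; exact hp.zero
  · exact ⟨smul_nonneg hc.le hp.1, by
      rw [ψ.map_smul hc hp.1]; exact ENNReal.mul_lt_top ENNReal.ofReal_lt_top hp.2⟩

lemma realVal_smul {ψ : Weight A} {p : A} (hp : ψ.FiniteAt p) {c : ℝ} (hc : 0 ≤ c) :
    ψ.realVal (c • p) = c * ψ.realVal p := by
  rcases hc.eq_or_lt with rfl | hc
  · rw [zero_smul, zero_mul, realVal_zero hp.zero]
  · rw [realVal, realVal, dif_pos hp.1, dif_pos (smul_nonneg hc.le hp.1), ψ.map_smul hc hp.1,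
      ENNReal.toReal_mul, ENNReal.toReal_ofReal hc.le]

/-- `x = p - q + i (r - s)` with positive elements `p, q, r, s` of finite weight, and `z` is the
corresponding combination of the weights. -/
def Rep (ψ : Weight A) (x : A) (z : ℂ) : Prop :=
  ∃ p q r s : A, ψ.FiniteAt p ∧ ψ.FiniteAt q ∧ ψ.FiniteAt r ∧ ψ.FiniteAt s ∧
    x = (p - q) + Complex.I • (r - s) ∧
    z = ((ψ.realVal p - ψ.realVal q : ℝ) : ℂ) + Complex.I * ((ψ.realVal r - ψ.realVal s : ℝ) : ℂ)

lemma Rep.add {ψ : Weight A} {x y : A} {z w : ℂ} (hx : ψ.Rep x z) (hy : ψ.Rep y w) :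
    ψ.Rep (x + y) (z + w) := by
  obtain ⟨p, q, r, s, hp, hq, hr, hs, rfl, rfl⟩ := hx
  obtain ⟨p', q', r', s', hp', hq', hr', hs', rfl, rfl⟩ := hy
  refine ⟨p + p', q + q', r + r', s + s', hp.add hp', hq.add hq', hr.add hr', hs.add hs', ?_, ?_⟩
  · module
  · rw [realVal_add hp hp', realVal_add hq hq', realVal_add hr hr', realVal_add hs hs']
    push_cast
    ring

lemma Rep.nonneg_smul {ψ : Weight A} {x : A} {z : ℂ} (hx : ψ.Rep x z) {c : ℝ} (hc : 0 ≤ c) :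
    ψ.Rep (c • x) (c * z) := by
  obtain ⟨p, q, r, s, hp, hq, hr, hs, rfl, rfl⟩ := hx
  refine ⟨c • p, c • q, c • r, c • s, hp.smul hc, hq.smul hc, hr.smul hc, hs.smul hc, ?_, ?_⟩
  · rw [smul_add, smul_comm c Complex.I, smul_sub, smul_sub]
  · rw [realVal_smul hp hc, realVal_smul hq hc, realVal_smul hr hc, realVal_smul hs hc]
    push_cast
    ring

lemma Rep.I_smul {ψ : Weight A} {x : A} {z : ℂ} (hx : ψ.Rep x z) :
    ψ.Rep (Complex.I • x) (Complex.I * z) := by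
  obtain ⟨p, q, r, s, hp, hq, hr, hs, rfl, rfl⟩ := hx
  refine ⟨s, r, p, q, hs, hr, hp, hq, ?_, ?_⟩
  · rw [smul_add, smul_smul, Complex.I_mul_I]
    module
  · rw [mul_add, ← mul_assoc, Complex.I_mul_I]
    push_cast
    ring

lemma Rep.neg {ψ : Weight A} {x : A} {z : ℂ} (hx : ψ.Rep x z) : ψ.Rep (-x) (-z) := by
  have h := hx.I_smul.I_smul
  rwa [smul_smul, ← mul_assoc, Complex.I_mul_I, neg_one_smul, neg_one_mul] at h

lemma Rep.real_smul {ψ : Weight A} {x : A} {z : ℂ} (hx : ψ.Rep x z) (c : ℝ) :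
    ψ.Rep (c • x) (c * z) := by
  rcases le_total 0 c with hc | hc
  · exact hx.nonneg_smul hc
  · have h := (hx.nonneg_smul (neg_nonneg.2 hc)).neg
    rwa [neg_smul, neg_neg, Complex.ofReal_neg, neg_mul, neg_neg] at h

lemma Rep.smul {ψ : Weight A} {x : A} {z : ℂ} (hx : ψ.Rep x z) (c : ℂ) :
    ψ.Rep (c • x) (c * z) := by
  have h := (hx.real_smul c.re).add (hx.real_smul c.im).I_smul
  have h1 : c.re • x + Complex.I • c.im • x = c • x := by
    conv_rhs => rw [← Complex.re_add_im c]
    rw [add_smul, mul_comm, mul_smul, Complex.coe_smul, Complex.coe_smul]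
  have h2 : (c.re : ℂ) * z + Complex.I * (c.im * z) = c * z := by
    conv_rhs => rw [← Complex.re_add_im c]
    ring
  rwa [h1, h2] at h

lemma Rep.of_fin {ψ : Weight A} {p : A} (hp : ψ.FiniteAt p) : ψ.Rep p (ψ.realVal p) := by
  refine ⟨p, 0, 0, 0, hp, hp.zero, hp.zero, hp.zero, by simp, ?_⟩
  rw [realVal_zero hp.zero]
  simp

lemma parts_eq {a b c d : A} (ha : IsSelfAdjoint a) (hb : IsSelfAdjoint b)
    (hc : IsSelfAdjoint c) (hd : IsSelfAdjoint d)
    (h : a + Complex.I • b = c + Complex.I • d) : a = c ∧ b = d := by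
  have h' := congrArg star h
  simp only [star_add, star_smul, ha.star_eq, hb.star_eq, hc.star_eq, hd.star_eq,
    Complex.star_def, Complex.conj_I, neg_smul] at h'
  have h1 : (2 : ℂ) • a = (2 : ℂ) • c := by
    rw [two_smul, two_smul]
    calc a + a = (a + Complex.I • b) + (a + -(Complex.I • b)) := by abel
      _ = (c + Complex.I • d) + (c + -(Complex.I • d)) := by rw [h, h']
      _ = c + c := by abel
  have h2 : a = c := smul_right_injective A (two_ne_zero (α := ℂ)) h1
  subst h2
  exact ⟨rfl, smul_right_injective A Complex.I_ne_zero (add_left_cancel h)⟩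

lemma realVal_sub_eq {ψ : Weight A} {p q p' q' : A} (hp : ψ.FiniteAt p) (hq : ψ.FiniteAt q)
    (hp' : ψ.FiniteAt p') (hq' : ψ.FiniteAt q') (h : p - q = p' - q') :
    ψ.realVal p - ψ.realVal q = ψ.realVal p' - ψ.realVal q' := by
  have h1 : p + q' = p' + q := by
    rw [sub_eq_sub_iff_add_eq_add] at h
    exact h
  have h2 := congrArg ψ.realVal h1
  rw [realVal_add hp hq', realVal_add hp' hq] at h2
  linarith

lemma Rep.unique {ψ : Weight A} {x : A} {z w : ℂ} (hz : ψ.Rep x z) (hw : ψ.Rep x w) :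
    z = w := by
  obtain ⟨p, q, r, s, hp, hq, hr, hs, rfl, rfl⟩ := hz
  obtain ⟨p', q', r', s', hp', hq', hr', hs', h, rfl⟩ := hw
  obtain ⟨h1, h2⟩ := parts_eq
    ((IsSelfAdjoint.of_nonneg hp.1).sub (IsSelfAdjoint.of_nonneg hq.1))
    ((IsSelfAdjoint.of_nonneg hr.1).sub (IsSelfAdjoint.of_nonneg hs.1))
    ((IsSelfAdjoint.of_nonneg hp'.1).sub (IsSelfAdjoint.of_nonneg hq'.1))
    ((IsSelfAdjoint.of_nonneg hr'.1).sub (IsSelfAdjoint.of_nonneg hs'.1)) h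
  rw [realVal_sub_eq hp hq hp' hq' h1, realVal_sub_eq hr hs hr' hs' h2]

lemma fin_of_mem_N {ψ : Weight A} {a : A} (ha : a ∈ ψ.N) : ψ.FiniteAt (star a * a) :=
  ⟨star_mul_self_nonneg a, ha⟩

lemma fin_of_le {ψ : Weight A} {p q : A} (hp : 0 ≤ p) (hq : ψ.FiniteAt q) (h : p ≤ q) : ψ.FiniteAt p :=
  ⟨hp, (ψ.mono hp hq.1 h).trans_lt hq.2⟩

lemma smul_mem_N {ψ : Weight A} {a : A} (ha : a ∈ ψ.N) (c : ℂ) : c • a ∈ ψ.N := by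
  have h := (fin_of_mem_N ha).smul (Complex.normSq_nonneg c)
  have h1 : star (c • a) * (c • a) = Complex.normSq c • (star a * a) := by
    rw [star_smul, smul_mul_smul_comm, Complex.star_def, ← Complex.normSq_eq_conj_mul_self,
      Complex.coe_smul]
  rw [← h1] at h
  exact h.2

lemma add_mem_N {ψ : Weight A} {a b : A} (ha : a ∈ ψ.N) (hb : b ∈ ψ.N) : a + b ∈ ψ.N := by
  have h := ((fin_of_mem_N ha).add (fin_of_mem_N hb)).smul (zero_le_two (α := ℝ))
  have h1 : star (a + b) * (a + b) ≤ (2 : ℝ) • (star a * a + star b * b) := by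
    rw [← sub_nonneg]
    have h2 : (2 : ℝ) • (star a * a + star b * b) - star (a + b) * (a + b)
        = star (a - b) * (a - b) := by
      rw [two_smul, star_add, star_sub]
      noncomm_ring
    rw [h2]
    exact star_mul_self_nonneg _
  exact (fin_of_le (star_mul_self_nonneg _) h h1).2

lemma exists_rep_star_mul {ψ : Weight A} {a b : A} (ha : a ∈ ψ.N) (hb : b ∈ ψ.N) :
    ∃ z, ψ.Rep (star a * b) z := by
  have key : ∀ c : ℂ, ψ.Rep (star (b + c • a) * (b + c • a))
      (ψ.realVal (star (b + c • a) * (b + c • a))) := fun c =>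
    Rep.of_fin (fin_of_mem_N (add_mem_N hb (smul_mem_N ha c)))
  have h := ((((key 1).add (key (-1)).neg).add (((key Complex.I).smul Complex.I).add
    (((key (-Complex.I)).smul Complex.I).neg))).smul (1 / 4))
  have e : ∀ c : ℂ, star (b + c • a) * (b + c • a) = star b * b + c • (star b * a)
      + star c • (star a * b) + (star c * c) • (star a * a) := by
    intro c
    rw [star_add, star_smul, add_mul, mul_add, mul_add, mul_smul_comm, smul_mul_assoc,
      smul_mul_smul_comm]
    abel
  have e2 : star a * b = (1 / 4 : ℂ) • (star (b + (1 : ℂ) • a) * (b + (1 : ℂ) • a)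
      + -(star (b + (-1 : ℂ) • a) * (b + (-1 : ℂ) • a))
      + (Complex.I • (star (b + Complex.I • a) * (b + Complex.I • a))
        + -(Complex.I • (star (b + (-Complex.I) • a) * (b + (-Complex.I) • a))))) := by
    rw [e, e, e, e]
    simp only [star_one, star_neg, Complex.star_def, Complex.conj_I, neg_neg]
    simp only [smul_add, smul_smul, neg_smul, mul_neg, neg_mul, Complex.I_mul_I, one_smul,
      mul_one, neg_neg]
    match_scalars <;> ring_nf <;> rw [Complex.I_sq] <;> norm_num
  rw [← e2] at h
  exact ⟨_, h⟩

/-- Every element of `M_ψ` is a linear combination of positive elements of finite weight. -/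
lemma exists_rep_of_mem {ψ : Weight A} (hψ : ∃ p, ψ.FiniteAt p) {x : A} (hx : x ∈ ψ.M) :
    ∃ z, ψ.Rep x z := by
  obtain ⟨p, hp⟩ := hψ
  induction hx using Submodule.span_induction with
  | mem x h =>
    obtain ⟨a, ha, b, hb, rfl⟩ := h
    exact exists_rep_star_mul ha hb
  | zero => exact ⟨_, Rep.of_fin hp.zero⟩
  | add x y _ _ hx hy =>
    obtain ⟨z, hz⟩ := hx
    obtain ⟨w, hw⟩ := hy
    exact ⟨_, hz.add hw⟩
  | smul c x _ hx =>
    obtain ⟨z, hz⟩ := hx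
    exact ⟨_, hz.smul c⟩

/-- Positive elements of finite weight belong to `M_ψ`. -/
lemma mem_M_of_fin {ψ : Weight A} {p : A} (hp : ψ.FiniteAt p) : p ∈ ψ.M := by
  have h : star (CFC.sqrt p) * CFC.sqrt p = p := by
    rw [(IsSelfAdjoint.of_nonneg (CFC.sqrt_nonneg p)).star_eq]
    exact CFC.sqrt_mul_sqrt_self p hp.1
  have h2 : CFC.sqrt p ∈ ψ.N := by
    have h3 := hp
    rw [← h] at h3
    exact h3.2
  exact Submodule.subset_span ⟨_, h2, _, h2, h.symm⟩

/-- A positive element of `M_ψ` has finite weight. -/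
lemma fin_of_mem_M {ψ : Weight A} (hψ : ∃ p, ψ.FiniteAt p) {x : A} (hx : x ∈ ψ.M) (h0 : 0 ≤ x) :
    ψ.FiniteAt x := by
  obtain ⟨z, p, q, r, s, hp, hq, hr, hs, h, -⟩ := exists_rep_of_mem hψ hx
  obtain ⟨h1, -⟩ := parts_eq (IsSelfAdjoint.of_nonneg h0) (IsSelfAdjoint.zero A)
    ((IsSelfAdjoint.of_nonneg hp.1).sub (IsSelfAdjoint.of_nonneg hq.1))
    ((IsSelfAdjoint.of_nonneg hr.1).sub (IsSelfAdjoint.of_nonneg hs.1)) (by simpa using h)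
  exact fin_of_le h0 hp (h1 ▸ sub_le_self p hq.1)

/-- `L` is a linear extension of `ψ : M_ψ ∩ A₊ → [0, ∞)` to `M_ψ`. -/
def IsLinearExtension (ψ : Weight A) (L : ψ.M →ₗ[ℂ] ℂ) : Prop :=
  ∀ (x : ψ.M) (hx : 0 ≤ (x : A)), ψ ⟨x, hx⟩ < ∞ ∧ L x = ((ψ ⟨x, hx⟩).toReal : ℂ)

/-- A weight that is finite somewhere has a unique linear extension to `M_ψ`. -/
theorem existsUnique_linearExtension (ψ : Weight A) (hψ : ∃ a, ψ a < ∞) :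
    ∃! L : ψ.M →ₗ[ℂ] ℂ, ψ.IsLinearExtension L := by
  have hψ' : ∃ p, ψ.FiniteAt p := by
    obtain ⟨a, ha⟩ := hψ
    exact ⟨a, a.2, ha⟩
  have hex : ∀ x : ψ.M, ∃ z, ψ.Rep x z := fun x => exists_rep_of_mem hψ' x.2
  choose f hf using hex
  refine ⟨{ toFun := f, map_add' := fun x y => ?_, map_smul' := fun c x => ?_ }, ?_, ?_⟩
  · exact (hf (x + y)).unique ((hf x).add (hf y))
  · exact (hf (c • x)).unique ((hf x).smul c)
  · intro x hx
    have h := fin_of_mem_M hψ' x.2 hx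
    refine ⟨h.2, ?_⟩
    have h1 := (hf x).unique (Rep.of_fin h)
    rw [realVal, dif_pos hx] at h1
    exact h1
  · intro L hL
    have hre : ∀ (p : A) (hp : ψ.FiniteAt p), L ⟨p, mem_M_of_fin hp⟩ = (ψ.realVal p : ℂ) := by
      intro p hp
      rw [(hL ⟨p, mem_M_of_fin hp⟩ hp.1).2, realVal, dif_pos hp.1]
    ext x
    obtain ⟨p, q, r, s, hp, hq, hr, hs, h, h'⟩ := hf x
    have hx : x = (⟨p, mem_M_of_fin hp⟩ - ⟨q, mem_M_of_fin hq⟩ : ψ.M)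
        + Complex.I • (⟨r, mem_M_of_fin hr⟩ - ⟨s, mem_M_of_fin hs⟩ : ψ.M) := Subtype.ext h
    change L x = f x
    rw [h', hx, _root_.map_add, _root_.map_smul, map_sub, map_sub, hre p hp, hre q hq, hre r hr,
      hre s hs]
    push_cast
    rfl

open Classical in
/-- The linear extension of `ψ` to `M_ψ`; it is the one of `existsUnique_linearExtension`
whenever `ψ` is finite somewhere, in particular for every proper weight. -/
def linExt (ψ : Weight A) : ψ.M →ₗ[ℂ] ℂ :=
  if h : ∃ a, ψ a < ∞ then (ψ.existsUnique_linearExtension h).choose else 0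

lemma IsProper.isLinearExtension_linExt {ψ : Weight A} (hψ : ψ.IsProper) :
    ψ.IsLinearExtension ψ.linExt := by
  have h : ∃ a, ψ a < ∞ := by
    have : Nonempty {a : A // 0 ≤ a} := ⟨⟨0, le_rfl⟩⟩
    exact hψ.densely_defined.nonempty
  rw [linExt, dif_pos h]
  exact (ψ.existsUnique_linearExtension h).choose_spec.1

end Weight

/-- Continuous one-parameter groups of automorphisms of a C⋆-algebra: actions of `ℝ` by
⋆-automorphisms such that each orbit map `t ↦ γ t a` is norm continuous. -/
structure OneParameterGroup (A : Type*) [NonUnitalCStarAlgebra A] where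
  toFun : ℝ → A ≃⋆ₐ[ℂ] A
  map_zero' : ∀ a, toFun 0 a = a
  map_add' : ∀ s t a, toFun (s + t) a = toFun s (toFun t a)
  continuous' : ∀ a, Continuous fun t => toFun t a

instance (A : Type*) [NonUnitalCStarAlgebra A] :
    CoeFun (OneParameterGroup A) (fun _ => ℝ → A ≃⋆ₐ[ℂ] A) := ⟨OneParameterGroup.toFun⟩

lemma map_nonneg_of_starAlgEquiv (φ : A ≃⋆ₐ[ℂ] A) {a : A} (ha : 0 ≤ a) : 0 ≤ φ a :=
  map_nonneg φ ha

/-- Invariance of a weight under a one-parameter group. -/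
def Weight.IsInvariant (ψ : Weight A) (γ : OneParameterGroup A) : Prop :=
  ∀ (t : ℝ) (a : {a : A // 0 ≤ a}), ψ ⟨γ t a, map_nonneg_of_starAlgEquiv (γ t) a.2⟩ = ψ a

lemma Weight.IsInvariant.map_mem_N {ψ : Weight A} {γ : OneParameterGroup A}
    (h : ψ.IsInvariant γ) (t : ℝ) {a : A} (ha : a ∈ ψ.N) : γ t a ∈ ψ.N := by
  have h1 := h t ⟨star a * a, star_mul_self_nonneg a⟩
  have h2 : (⟨star (γ t a) * γ t a, star_mul_self_nonneg _⟩ : {a : A // 0 ≤ a})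
      = ⟨γ t (star a * a), map_nonneg_of_starAlgEquiv (γ t) (star_mul_self_nonneg a)⟩ :=
    Subtype.ext (by simp [map_star])
  change ψ _ < ∞
  rw [h2, h1]
  exact ha

lemma Weight.mul_mem_M {ψ : Weight A} {a b : A} (ha : star a ∈ ψ.N) (hb : b ∈ ψ.N) :
    a * b ∈ ψ.M :=
  Submodule.subset_span ⟨star a, ha, b, hb, by rw [star_star]⟩

lemma Weight.IsInvariant.mul_map_mem_M {ψ : Weight A} {γ : OneParameterGroup A}
    (h : ψ.IsInvariant γ) (t : ℝ) {a b : A} (ha : star a ∈ ψ.N) (hb : b ∈ ψ.N) :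
    a * γ t b ∈ ψ.M :=
  Weight.mul_mem_M ha (h.map_mem_N t hb)

lemma Weight.IsInvariant.map_mul_mem_M {ψ : Weight A} {γ : OneParameterGroup A}
    (h : ψ.IsInvariant γ) (t : ℝ) {a b : A} (ha : a ∈ ψ.N) (hb : star b ∈ ψ.N) :
    γ t b * a ∈ ψ.M :=
  Weight.mul_mem_M (by rw [← map_star]; exact h.map_mem_N t hb) ha

/-- The closed strip of all complex numbers whose imaginary part lies between `0` and `β`. -/
def strip (β : ℝ) : Set ℂ := {z | z.im ∈ Set.uIcc 0 β}

/-- `β`-KMS weights for a continuous one-parameter group `γ`. -/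
structure IsKMSWeight (ψ : Weight A) (γ : OneParameterGroup A) (β : ℝ) : Prop where
  proper : ψ.IsProper
  invariant : ψ.IsInvariant γ
  kms : ∀ (a b : A) (ha : a ∈ ψ.N) (ha' : star a ∈ ψ.N) (hb : b ∈ ψ.N) (hb' : star b ∈ ψ.N),
    ∃ F : ℂ → ℂ, ContinuousOn F (strip β) ∧ (∃ C : ℝ, ∀ z ∈ strip β, ‖F z‖ ≤ C) ∧
      DifferentiableOn ℂ F (interior (strip β)) ∧
      ∀ t : ℝ, F t = ψ.linExt ⟨a * γ t b, invariant.mul_map_mem_M t ha' hb⟩ ∧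
        F (t + Complex.I * β) = ψ.linExt ⟨γ t b * a, invariant.map_mul_mem_M t ha hb'⟩

/-- Conditional expectations of a C⋆-algebra `A` onto an abelian C⋆-subalgebra `D`: positive
contractive linear maps that restrict to the identity on `D` and are `D`-bimodule maps.
(Positive maps into abelian C⋆-algebras are automatically completely positive.) -/
structure IsConditionalExpectation (D : NonUnitalStarSubalgebra ℂ A) (P : A →ₗ[ℂ] D) : Prop where
  nonneg : ∀ a : A, 0 ≤ a → 0 ≤ (P a : A)
  norm_le : ∀ a : A, ‖P a‖ ≤ ‖a‖
  apply_coe : ∀ d : D, P d = d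
  mul_left : ∀ (d : D) (a : A), P (d * a) = d * P a
  mul_right : ∀ (a : A) (d : D), P (a * d) = P a * d

/-- Simple C⋆-algebras: nonzero, without closed two-sided ideals other than `0` and `A`. -/
structure IsSimpleCStarAlgebra (A : Type*) [NonUnitalCStarAlgebra A] : Prop where
  nontrivial : Nontrivial A
  eq_bot_or_eq_top : ∀ I : TwoSidedIdeal A, IsClosed (I : Set A) → I = ⊥ ∨ I = ⊤

end KMS

end

/-! Let `L` be the left kernel, the set of `a` with `ω(a⋆a) = 0`. It is a left ideal, closed because
`ω` is lower semicontinuous. If `a ∈ L` and `a⋆ ∈ N_ω`, the KMS function of the pair `(a, a⋆)`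
equals `ω(γ_t(a⋆)a)` on the line `Im z = β`, which is `0` by Cauchy–Schwarz. A bounded holomorphic
function vanishing on one side of a strip vanishes, so `ω(aa⋆) = 0`. Density of `N_ω` and an
approximate unit remove the condition `a⋆ ∈ N_ω`. Hence `L` is a two-sided ideal, and simplicity
with `ω ≠ 0` forces `L = 0` (`IsKMSWeight.eq_zero_of_mem_leftKernel`).

For `d ∈ D ∩ N_ω`, invariance under `P` and commutativity of `D` give `ω(dγ_t(b)) = ω(γ_t(b)d)`. The
KMS function of `(d, b)` then has equal values on both sides of the strip, extends periodically to a
bounded entire function, and is constant by Liouville. So `ω(dγ_t(b)) = ω(db) = ω(γ_t(d)γ_t(b))`;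
choosing `γ_t(b) = (γ_t(d) - d)⋆` and using `L = 0` gives `γ_t(d) = d`
(`IsKMSWeight.map_eq_self_of_mem_N`). The rest of `D` follows by continuity. -/

namespace KMS

/-! ### Bounded holomorphic functions on the unit strip -/

open Complex Set in
/-- Removability of a vertical line for continuous functions: a continuous function that is
holomorphic off the line on a vertical strip around it is holomorphic on the strip. -/
lemma differentiableOn_of_continuous_of_off_line {f : ℂ → ℂ} (hf : Continuous f) (c δ : ℝ)
    (hd : ∀ z : ℂ, z.re ≠ c → |z.re - c| < δ → DifferentiableAt ℂ f z) :
    DifferentiableOn ℂ f {z : ℂ | |z.re - c| < δ} := by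
  have hU : IsOpen {z : ℂ | |z.re - c| < δ} :=
    isOpen_lt (by fun_prop) continuous_const
  -- Morera: it suffices that integrals over rectangle boundaries vanish.
  rw [← isConservativeOn_and_continuousOn_iff_isDifferentiableOn hU]
  refine ⟨fun z w hzw => ?_, hf.continuousOn⟩
  rw [← add_eq_zero_iff_eq_neg, wedgeIntegral_add_wedgeIntegral_eq]
  have hz : |z.re - c| < δ := hzw (by simp [Rectangle, mem_reProdIm])
  have hw : |w.re - c| < δ := hzw (by simp [Rectangle, mem_reProdIm])
  -- The rectangle is cut along `Re = c`. The open halves avoid the line, and Cauchy's theorem needs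
  -- only continuity on their boundaries. Integrals are oriented, so `c` need not lie between `z.re`
  -- and `w.re`.
  have h1 := integral_boundary_rect_eq_zero_of_continuousOn_of_differentiableOn f z
    (c + w.im * I) hf.continuousOn (by
      rintro p ⟨hp, -⟩
      simp only [mem_preimage, mem_Ioo, add_re, ofReal_re, mul_re, I_re, mul_zero, ofReal_im, I_im,
        mul_one, sub_self, add_zero] at hp
      exact (hd p (by grind) (by grind)).differentiableWithinAt)
  have h2 := integral_boundary_rect_eq_zero_of_continuousOn_of_differentiableOn f
    (c + z.im * I) w hf.continuousOn (by
      rintro p ⟨hp, -⟩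
      simp only [mem_preimage, mem_Ioo, add_re, ofReal_re, mul_re, I_re, mul_zero, ofReal_im, I_im,
        mul_one, sub_self, add_zero] at hp
      exact (hd p (by grind) (by grind)).differentiableWithinAt)
  have hi : ∀ y a b : ℝ, IntervalIntegrable (fun x : ℝ => f (x + y * I)) MeasureTheory.volume a b :=
    fun y a b => Continuous.intervalIntegrable (by fun_prop) a b
  simp only [add_re, ofReal_re, mul_re, I_re, mul_zero, ofReal_im, I_im,
        mul_one, sub_self, add_zero, add_im, mul_im, zero_add] at h1 h2
  rw [← intervalIntegral.integral_add_adjacent_intervals (hi z.im z.re c) (hi z.im c w.re),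
    ← intervalIntegral.integral_add_adjacent_intervals (hi w.im z.re c) (hi w.im c w.re)]
  linear_combination h1 + h2

open Complex Set in
/-- A bounded function on the closed unit strip that is holomorphic inside and takes the same values
on the two boundary lines is constant on the boundary. -/
lemma eq_of_boundary_values_eq {H : ℂ → ℂ} (hc : ContinuousOn H {z | z.re ∈ Icc 0 1})
    {C : ℝ} (hb : ∀ z : ℂ, z.re ∈ Icc (0 : ℝ) 1 → ‖H z‖ ≤ C)
    (hd : DifferentiableOn ℂ H {z | z.re ∈ Ioo 0 1})
    (h01 : ∀ y : ℝ, H (y * I) = H (1 + y * I)) (y : ℝ) : H (y * I) = H 0 := by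
  -- The 1-periodic extension of `H`: `h01` makes it continuous across the lines `Re ∈ ℤ`, these
  -- lines are removable, and Liouville applies.
  set K : ℂ → ℂ := fun w => H ((Int.fract w.re : ℝ) + w.im * I) with hK
  have hKc : Continuous K := by
    refine ContinuousOn.comp_fract (f := fun (w : ℂ) (x : ℝ) => H (x + w.im * I)) ?_
      continuous_re ?_
    · refine hc.comp (f := fun p : ℂ × ℝ => (p.2 + p.1.im * I : ℂ)) (by fun_prop) ?_
      rintro ⟨w, x⟩ ⟨-, hx⟩
      simpa using hx
    · intro w
      simpa using h01 w.im
  have hint : ∀ w : ℂ, (∀ n : ℤ, w.re ≠ n) → DifferentiableAt ℂ K w := by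
    intro w hw
    have h0 : 0 < Int.fract w.re := by
      refine lt_of_le_of_ne (Int.fract_nonneg _) fun h => hw ⌊w.re⌋ ?_
      rw [← Int.floor_add_fract w.re, ← h]; simp
    have hlt := Int.fract_lt_one w.re
    have hsub : w - ⌊w.re⌋ = (Int.fract w.re : ℝ) + w.im * I := by
      apply Complex.ext <;> simp
    have hopen : IsOpen {z : ℂ | z.re ∈ Ioo (0 : ℝ) 1} := isOpen_Ioo.preimage continuous_re
    have hdw : DifferentiableAt ℂ (fun v : ℂ => H (v - ⌊w.re⌋)) w := by
      have : DifferentiableAt ℂ H (w - ⌊w.re⌋) := by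
        refine hd.differentiableAt (hopen.mem_nhds ?_)
        rw [hsub]; simpa using ⟨h0, hlt⟩
      exact this.comp w (by fun_prop)
    refine hdw.congr_of_eventuallyEq ?_
    have hev : ∀ᶠ v : ℂ in nhds w, v.re ∈ Ioo (⌊w.re⌋ : ℝ) (⌊w.re⌋ + 1) := by
      refine (isOpen_Ioo.preimage continuous_re).mem_nhds ?_
      have := Int.floor_add_fract w.re
      constructor <;> linarith
    filter_upwards [hev] with v hv
    have hfl : ⌊v.re⌋ = ⌊w.re⌋ := Int.floor_eq_iff.2 ⟨hv.1.le, hv.2⟩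
    simp only [hK]
    congr 1
    apply Complex.ext <;> simp [← hfl]
  have hKd : Differentiable ℂ K := by
    intro w
    by_cases hw : ∀ n : ℤ, w.re ≠ n
    · exact hint w hw
    · push Not at hw
      obtain ⟨n, hn⟩ := hw
      -- Half-width `1`: the open strip around `Re = n` meets no other integer line.
      have := differentiableOn_of_continuous_of_off_line hKc n 1 (fun z hz hz1 => by
        refine hint z fun m hm => hz ?_
        rw [hm] at hz1 ⊢
        have h1 : |m - n| < 1 := by exact_mod_cast hz1
        have h2 : m = n := by have := abs_lt.1 h1; omega
        rw [h2])
      refine this.differentiableAt ((isOpen_lt (by fun_prop) continuous_const).mem_nhds ?_)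
      simp [hn]
  have hbdd : Bornology.IsBounded (range K) := by
    refine isBounded_iff_forall_norm_le.2 ⟨C, ?_⟩
    rintro _ ⟨w, rfl⟩
    refine hb _ ?_
    simpa using (Int.fract_lt_one w.re).le
  have := hKd.apply_eq_apply_of_bounded hbdd (y * I) 0
  simpa [hK] using this

open Complex Set in
/-- A bounded function on the closed unit strip that is holomorphic inside and vanishes on one
boundary line vanishes on the strip. -/
lemma eq_zero_of_boundary_value_eq_zero {H : ℂ → ℂ} (hc : ContinuousOn H {z | z.re ∈ Icc 0 1})
    {C : ℝ} (hb : ∀ z : ℂ, z.re ∈ Icc (0 : ℝ) 1 → ‖H z‖ ≤ C)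
    (hd : DifferentiableOn ℂ H {z | z.re ∈ Ioo 0 1})
    (h1 : ∀ y : ℝ, H (1 + y * I) = 0) : H 0 = 0 := by
  have hcl : closure (HadamardThreeLines.verticalStrip 0 1) ⊆ {z | z.re ∈ Icc (0 : ℝ) 1} :=
    closure_minimal (fun z hz => Ioo_subset_Icc_self hz) (isClosed_Icc.preimage continuous_re)
  -- The three lines bound is `C ^ (1 - x) * 0 ^ x`, which vanishes only for `x > 0`; the point `0`
  -- is reached afterwards by continuity.
  have hpos : ∀ x ∈ Ioo (0 : ℝ) 1, H x = 0 := by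
    intro x hx
    have := HadamardThreeLines.norm_le_interp_of_mem_verticalClosedStrip₀₁' H (z := x) (a := C)
      (b := 0) (by simpa [HadamardThreeLines.verticalClosedStrip] using Ioo_subset_Icc_self hx)
      ⟨hd, hc.mono hcl⟩
      ⟨C, by rintro _ ⟨z, hz, rfl⟩; exact hb z hz⟩
      (fun z hz => hb z (by rw [show z.re = 0 from hz]; simp))
      (fun z hz => by
        have hz' : z.re = 1 := hz
        have := h1 z.im
        rw [show (1 + z.im * I : ℂ) = z by apply Complex.ext <;> simp [hz']] at this
        simp [this])
    rw [ofReal_re, Real.zero_rpow hx.1.ne', mul_zero] at this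
    simpa using this
  have hcr : ContinuousOn (fun x : ℝ => H x) (Icc 0 1) :=
    hc.comp (by fun_prop) (fun x hx => by simpa using hx)
  have hcl2 : ∀ x ∈ Icc (0 : ℝ) 1, H x = 0 := by
    have : EqOn (fun x : ℝ => H x) (fun _ => 0) (Icc 0 1) :=
      EqOn.of_subset_closure hpos hcr continuousOn_const Ioo_subset_Icc_self
        (by rw [closure_Ioo (by norm_num)])
    exact this
  simpa using hcl2 0 (by simp)

/-! ### Transfer to the KMS strip -/

section Strip

open Complex Set

variable {β : ℝ} {F : ℂ → ℂ}

/-- Multiplication by `iβ` takes `Re w = 0` to the real axis and, for either sign of `β`, `Re w = 1`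
to `Im z = β`. This reduces both strip statements to the unit strip. -/
lemma rotate_mem_strip {w : ℂ} (hw : w.re ∈ Icc (0 : ℝ) 1) : I * β * w ∈ strip β := by
  have : (I * β * w).im = w.re * β := by simp [mul_comm]
  rw [strip, mem_ofPred_eq, this, mem_uIcc]
  rcases le_total 0 β with h | h
  · left; constructor <;> nlinarith [hw.1, hw.2]
  · right; constructor <;> nlinarith [hw.1, hw.2]

lemma rotate_mem_interior_strip (hβ : β ≠ 0) {w : ℂ} (hw : w.re ∈ Ioo (0 : ℝ) 1) :
    I * β * w ∈ interior (strip β) := by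
  have : (I * β * w).im = w.re * β := by simp [mul_comm]
  refine mem_interior.2 ⟨im ⁻¹' Ioo (min 0 β) (max 0 β),
    fun z hz => Ioo_subset_Icc_self hz, isOpen_Ioo.preimage continuous_im, ?_⟩
  rw [mem_preimage, this]
  rcases lt_or_gt_of_ne hβ with h | h
  · rw [min_eq_right h.le, max_eq_left h.le]; constructor <;> nlinarith [hw.1, hw.2]
  · rw [min_eq_left h.le, max_eq_right h.le]; constructor <;> nlinarith [hw.1, hw.2]

lemma continuousOn_rotate (hc : ContinuousOn F (strip β)) :
    ContinuousOn (fun w => F (I * β * w)) {w | w.re ∈ Icc 0 1} :=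
  hc.comp (by fun_prop) fun _ hw => rotate_mem_strip hw

lemma differentiableOn_rotate (hβ : β ≠ 0) (hd : DifferentiableOn ℂ F (interior (strip β))) :
    DifferentiableOn ℂ (fun w => F (I * β * w)) {w | w.re ∈ Ioo 0 1} :=
  hd.comp (by fun_prop) fun _ hw => rotate_mem_interior_strip hβ hw

/-- A bounded continuous function on the closed strip, holomorphic inside and with the same values
on the two boundary lines, is constant on the real line. -/
lemma strip_eq_of_boundary_values_eq (hβ : β ≠ 0) (hc : ContinuousOn F (strip β))
    (hb : ∃ C : ℝ, ∀ z ∈ strip β, ‖F z‖ ≤ C) (hd : DifferentiableOn ℂ F (interior (strip β)))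
    (h : ∀ t : ℝ, F t = F (t + I * β)) (t : ℝ) : F t = F 0 := by
  obtain ⟨C, hC⟩ := hb
  have hβ' : (β : ℂ) ≠ 0 := ofReal_ne_zero.2 hβ
  -- Since `iβ · iy = -βy`, height `y` in the unit strip is time `-βy`, and time `t` is height
  -- `-t/β`.
  have key := eq_of_boundary_values_eq (continuousOn_rotate hc)
    (fun z hz => hC _ (rotate_mem_strip hz)) (differentiableOn_rotate hβ hd) (fun y => by
      have := h (-(β * y))
      push_cast at this
      convert this using 2
      · linear_combination β * y * I_mul_I
      · linear_combination β * y * I_mul_I) (-(t / β))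
  have e : (I * β * ((-(t / β) : ℝ) * I) : ℂ) = t := by
    push_cast
    field_simp
    simp
  simpa only [e, mul_zero] using key

/-- A bounded continuous function on the closed strip, holomorphic inside and vanishing on the
boundary line off the real axis, vanishes at the origin. -/
lemma strip_eq_zero_of_boundary_value_eq_zero (hβ : β ≠ 0) (hc : ContinuousOn F (strip β))
    (hb : ∃ C : ℝ, ∀ z ∈ strip β, ‖F z‖ ≤ C) (hd : DifferentiableOn ℂ F (interior (strip β)))
    (h : ∀ t : ℝ, F (t + I * β) = 0) : F 0 = 0 := by
  obtain ⟨C, hC⟩ := hb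
  have key := eq_zero_of_boundary_value_eq_zero (continuousOn_rotate hc)
    (fun z hz => hC _ (rotate_mem_strip hz)) (differentiableOn_rotate hβ hd) (fun y => by
      have := h (-(β * y))
      push_cast at this
      convert this using 2
      linear_combination β * y * I_mul_I)
  simpa only [mul_zero] using key

end Strip

end KMS

/-! ### The linear extension and the left kernel of a proper weight -/

namespace KMS

variable {A : Type*} [NonUnitalCStarAlgebra A] [PartialOrder A] [StarOrderedRing A]

namespace Weight

variable {ψ : Weight A}

lemma IsProper.exists_finiteAt (hψ : ψ.IsProper) : ∃ p, ψ.FiniteAt p := by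
  have : Nonempty {a : A // 0 ≤ a} := ⟨⟨0, le_rfl⟩⟩
  obtain ⟨a, ha⟩ := hψ.densely_defined.nonempty
  exact ⟨a, a.2, ha⟩

lemma IsProper.map_zero (hψ : ψ.IsProper) : ψ ⟨0, le_rfl⟩ = 0 := by
  obtain ⟨p, hp⟩ := hψ.exists_finiteAt
  exact ψ.map_zero_of_lt_top hp.1 hp.2

/-- Together with `rep_linExt`, this moves identities for `linExt` to `Rep`, which carries no
membership proofs and is easily transported along `star`, `γ t` and `P`. -/
lemma IsProper.linExt_eq_of_rep (hψ : ψ.IsProper) {x : A} (hx : x ∈ ψ.M) {z : ℂ}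
    (h : ψ.Rep x z) : ψ.linExt ⟨x, hx⟩ = z := by
  obtain ⟨p, q, r, s, hp, hq, hr, hs, h, rfl⟩ := h
  have hre : ∀ (p : A) (hp : ψ.FiniteAt p),
      ψ.linExt ⟨p, mem_M_of_fin hp⟩ = (ψ.realVal p : ℂ) := by
    intro p hp
    rw [(hψ.isLinearExtension_linExt ⟨p, mem_M_of_fin hp⟩ hp.1).2, realVal, dif_pos hp.1]
  have hx' : (⟨x, hx⟩ : ψ.M) = (⟨p, mem_M_of_fin hp⟩ - ⟨q, mem_M_of_fin hq⟩ : ψ.M)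
      + Complex.I • (⟨r, mem_M_of_fin hr⟩ - ⟨s, mem_M_of_fin hs⟩ : ψ.M) := Subtype.ext h
  rw [hx', _root_.map_add, _root_.map_smul, map_sub, map_sub, hre p hp, hre q hq, hre r hr,
    hre s hs]
  push_cast
  rfl

lemma IsProper.rep_linExt (hψ : ψ.IsProper) {x : A} (hx : x ∈ ψ.M) :
    ψ.Rep x (ψ.linExt ⟨x, hx⟩) := by
  obtain ⟨z, hz⟩ := exists_rep_of_mem hψ.exists_finiteAt hx
  rwa [hψ.linExt_eq_of_rep hx hz]

lemma Rep.star {x : A} {z : ℂ} (h : ψ.Rep x z) : ψ.Rep (star x) (star z) := by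
  obtain ⟨p, q, r, s, hp, hq, hr, hs, rfl, rfl⟩ := h
  refine ⟨p, q, s, r, hp, hq, hs, hr, ?_, ?_⟩
  · simp only [star_add, star_sub, star_smul, (IsSelfAdjoint.of_nonneg hp.1).star_eq,
      (IsSelfAdjoint.of_nonneg hq.1).star_eq, (IsSelfAdjoint.of_nonneg hr.1).star_eq,
      (IsSelfAdjoint.of_nonneg hs.1).star_eq, Complex.star_def, Complex.conj_I]
    module
  · simp only [star_add, star_mul', Complex.star_def, Complex.conj_I, Complex.conj_ofReal]
    push_cast
    ring

/-- The inequality that makes both `N_ψ` and the left kernel left ideals. -/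
lemma star_mul_self_le (a b : A) :
    star (b * a) * (b * a) ≤ ‖star b * b‖ • (star a * a) := by
  have := CStarAlgebra.star_left_conjugate_le_norm_smul (a := a) (b := star b * b)
    (IsSelfAdjoint.star_mul_self b)
  rwa [star_mul, mul_assoc, ← mul_assoc (star b), ← mul_assoc]

lemma mul_mem_N {a : A} (ha : a ∈ ψ.N) (b : A) : b * a ∈ ψ.N :=
  (fin_of_le (star_mul_self_nonneg _) ((fin_of_mem_N ha).smul (norm_nonneg _))
    (star_mul_self_le a b)).2

/-- The positive elements of finite weight belong to `N_ψ`. -/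
lemma FiniteAt.mem_N {p : A} (hp : ψ.FiniteAt p) : p ∈ ψ.N := by
  have h : star (CFC.sqrt p) * CFC.sqrt p = p := by
    rw [(IsSelfAdjoint.of_nonneg (CFC.sqrt_nonneg p)).star_eq]
    exact CFC.sqrt_mul_sqrt_self p hp.1
  have h2 : CFC.sqrt p ∈ ψ.N := by
    have h3 := hp
    rw [← h] at h3
    exact h3.2
  have := mul_mem_N h2 (star (CFC.sqrt p))
  rwa [h] at this

/-- The span of the positive elements of finite weight is dense. -/
lemma IsProper.dense_span_finiteAt (hψ : ψ.IsProper) :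
    Dense (Submodule.span ℂ {p | ψ.FiniteAt p} : Set A) := by
  set S := Submodule.span ℂ {p | ψ.FiniteAt p}
  have h : (⊤ : Submodule ℂ A) ≤ S.topologicalClosure := by
    rw [← CStarAlgebra.span_nonneg, Submodule.span_le]
    intro p hp
    have h1 := hψ.densely_defined ⟨p, hp⟩
    have h2 := image_closure_subset_closure_image (continuous_subtype_val)
      (Set.mem_image_of_mem Subtype.val h1)
    refine closure_mono ?_ h2
    rintro _ ⟨a, ha, rfl⟩
    exact Submodule.subset_span ⟨a.2, ha⟩
  exact fun x => h (Submodule.mem_top : x ∈ ⊤)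

lemma IsProper.dense_N (hψ : ψ.IsProper) : Dense ψ.N := by
  refine hψ.dense_span_finiteAt.mono ?_
  intro x hx
  obtain ⟨p, hp⟩ := hψ.exists_finiteAt
  induction hx using Submodule.span_induction with
  | mem x h => exact FiniteAt.mem_N h
  | zero => exact hp.zero.mem_N
  | add x y _ _ hx hy => exact add_mem_N hx hy
  | smul c x _ hx => exact smul_mem_N hx c

/-- The left kernel of a weight. -/
def leftKernel (ψ : Weight A) : Set A :=
  {a | ψ ⟨star a * a, star_mul_self_nonneg a⟩ = 0}

lemma leftKernel_subset_N : ψ.leftKernel ⊆ ψ.N := fun a ha => by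
  change ψ _ < ∞
  rw [show ψ ⟨star a * a, star_mul_self_nonneg a⟩ = 0 from ha]
  exact ENNReal.zero_lt_top

lemma IsProper.map_smul_eq_zero (hψ : ψ.IsProper) {p : A} (hp : 0 ≤ p) (h : ψ ⟨p, hp⟩ = 0)
    {c : ℝ} (hc : 0 ≤ c) : ψ ⟨c • p, smul_nonneg hc hp⟩ = 0 := by
  rcases hc.eq_or_lt with rfl | hc
  · simpa using hψ.map_zero
  · rw [ψ.map_smul hc hp, h, mul_zero]

lemma map_eq_zero_of_le {p q : A} (hp : 0 ≤ p) (hq : 0 ≤ q) (h : p ≤ q) (h0 : ψ ⟨q, hq⟩ = 0) :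
    ψ ⟨p, hp⟩ = 0 :=
  le_antisymm (h0 ▸ ψ.mono hp hq h) zero_le

lemma IsProper.zero_mem_leftKernel (hψ : ψ.IsProper) : (0 : A) ∈ ψ.leftKernel := by
  simpa [leftKernel] using hψ.map_zero

lemma IsProper.add_mem_leftKernel (hψ : ψ.IsProper) {a b : A} (ha : a ∈ ψ.leftKernel)
    (hb : b ∈ ψ.leftKernel) : a + b ∈ ψ.leftKernel := by
  have h1 : star (a + b) * (a + b) ≤ (2 : ℝ) • (star a * a + star b * b) := by
    rw [← sub_nonneg]
    have h2 : (2 : ℝ) • (star a * a + star b * b) - star (a + b) * (a + b)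
        = star (a - b) * (a - b) := by
      rw [two_smul, star_add, star_sub]
      noncomm_ring
    rw [h2]
    exact star_mul_self_nonneg _
  refine map_eq_zero_of_le _ _ h1 (hψ.map_smul_eq_zero
    (add_nonneg (star_mul_self_nonneg a) (star_mul_self_nonneg b)) ?_ zero_le_two)
  rw [ψ.map_add (star_mul_self_nonneg a) (star_mul_self_nonneg b)]
  exact add_eq_zero.2 ⟨ha, hb⟩

lemma IsProper.mul_mem_leftKernel (hψ : ψ.IsProper) {a : A} (ha : a ∈ ψ.leftKernel) (b : A) :
    b * a ∈ ψ.leftKernel :=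
  map_eq_zero_of_le _ _ (star_mul_self_le a b)
    (hψ.map_smul_eq_zero (star_mul_self_nonneg a) ha (norm_nonneg _))

lemma IsProper.isClosed_leftKernel (hψ : ψ.IsProper) : IsClosed ψ.leftKernel := by
  have h1 : Continuous fun a : A =>
      (⟨star a * a, star_mul_self_nonneg a⟩ : {a : A // 0 ≤ a}) := by fun_prop
  have h2 := (hψ.lsc.isClosed_preimage 0).preimage h1
  convert h2 using 1
  ext a
  simp [leftKernel]

/-- Elements of the left kernel are orthogonal to `N_ψ`. -/
lemma IsProper.linExt_star_mul_eq_zero (hψ : ψ.IsProper) {x a : A} (hx : x ∈ ψ.N)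
    (ha : a ∈ ψ.leftKernel) (h : star x * a ∈ ψ.M) : ψ.linExt ⟨star x * a, h⟩ = 0 := by
  set s := ψ.linExt ⟨star x * a, h⟩
  have hrep : ψ.Rep (star x * a) s := hψ.rep_linExt h
  have haN := leftKernel_subset_N ha
  have ha0 : ψ.realVal (star a * a) = 0 := by
    rw [realVal, dif_pos (star_mul_self_nonneg a),
      show ψ ⟨star a * a, star_mul_self_nonneg a⟩ = 0 from ha, ENNReal.toReal_zero]
  -- Expand `ψ((x + ca)⋆(x + ca)) ≥ 0`: the quadratic term in `c` drops out because `ψ(a⋆a) = 0`,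
  -- and a real-affine function of `c` bounded below has slope `s = 0`.
  have key : ∀ c : ℂ, (0 : ℝ) ≤ ψ.realVal (star x * x) + 2 * (c * s).re := by
    intro c
    have h1 := ((Rep.of_fin (fin_of_mem_N hx)).add ((hrep.smul c).add (hrep.smul c).star)).add
      ((Rep.of_fin (fin_of_mem_N haN)).smul (star c * c))
    have h2 : star x * x + (c • (star x * a) + star (c • (star x * a))) +
        (star c * c) • (star a * a) = star (x + c • a) * (x + c • a) := by
      simp only [star_add, star_smul, star_mul, star_star, add_mul, mul_add, mul_smul_comm,
        smul_mul_assoc]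
      module
    rw [h2] at h1
    have h3 := h1.unique (Rep.of_fin (fin_of_mem_N (add_mem_N hx (smul_mem_N haN c))))
    have h4 := congrArg Complex.re h3
    rw [ha0] at h4
    have h5 : 0 ≤ ψ.realVal (star (x + c • a) * (x + c • a)) := by
      rw [realVal, dif_pos (star_mul_self_nonneg _)]
      exact ENNReal.toReal_nonneg
    simp only [Complex.ofReal_zero, mul_zero, add_zero, Complex.add_re, Complex.star_def,
      Complex.conj_re, Complex.ofReal_re] at h4
    linarith
  by_contra hne
  have hpos : 0 < Complex.normSq s := Complex.normSq_pos.2 hne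
  -- This `c` gives `c * s = -(ψ(x⋆x) + 1)`, making the right side of `key` negative.
  have h6 := key (((-(ψ.realVal (star x * x) + 1) / Complex.normSq s : ℝ) : ℂ) * star s)
  have h7 : (((-(ψ.realVal (star x * x) + 1) / Complex.normSq s : ℝ) : ℂ) * star s * s).re
      = -(ψ.realVal (star x * x) + 1) := by
    rw [mul_assoc, Complex.star_def, ← Complex.normSq_eq_conj_mul_self, ← Complex.ofReal_mul,
      Complex.ofReal_re]
    field_simp
  rw [h7] at h6
  have h8 : 0 ≤ ψ.realVal (star x * x) := by
    rw [realVal, dif_pos (star_mul_self_nonneg _)]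
    exact ENNReal.toReal_nonneg
  linarith

lemma IsProper.linExt_star_mul_self_eq_zero_iff (hψ : ψ.IsProper) {a : A}
    (h : star a * a ∈ ψ.M) : ψ.linExt ⟨star a * a, h⟩ = 0 ↔ a ∈ ψ.leftKernel := by
  obtain ⟨h1, h2⟩ := hψ.isLinearExtension_linExt ⟨star a * a, h⟩ (star_mul_self_nonneg a)
  rw [h2, Complex.ofReal_eq_zero, ENNReal.toReal_eq_zero_iff, or_iff_left h1.ne]
  rfl

end Weight

/-! ### The left kernel of a KMS weight is a two-sided ideal; faithfulness -/

open Weight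

variable {ψ : Weight A} {γ : OneParameterGroup A} {β : ℝ}

/-- The KMS function of `(a, a⋆)` is `ψ(γ_t(a)⋆ a) = 0` on the far line, since `γ_t(a) ∈ N_ψ` is
orthogonal to the left kernel; its value at `0` is `ψ(aa⋆)`. -/
lemma IsKMSWeight.star_mem_leftKernel_of_mem_N (h : IsKMSWeight ψ γ β) (hβ : β ≠ 0) {a : A}
    (ha : a ∈ ψ.leftKernel) (ha' : star a ∈ ψ.N) : star a ∈ ψ.leftKernel := by
  have haN := leftKernel_subset_N ha
  obtain ⟨F, hc, hb, hd, hF⟩ := h.kms a (star a) haN ha' ha' (by rwa [star_star])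
  have h0 := strip_eq_zero_of_boundary_value_eq_zero hβ hc hb hd fun t => by
    rw [(hF t).2]
    have hm := h.proper.linExt_star_mul_eq_zero (h.invariant.map_mem_N t haN) ha
      (mul_mem_M (by rw [star_star]; exact h.invariant.map_mem_N t haN) haN)
    simpa only [map_star] using hm
  have h1 := (hF 0).1
  rw [Complex.ofReal_zero, h0] at h1
  rw [← h.proper.linExt_star_mul_self_eq_zero_iff (mul_mem_M (by rwa [star_star]) ha')]
  simpa only [γ.map_zero', star_star] using h1.symm

/-- For `e ∈ N_ψ` the previous lemma applies to `e⋆a`, whose adjoint `a⋆e` is in the left ideal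
`N_ψ`. Closedness extends `a⋆e ∈ leftKernel` to all `e`, and `e` then runs through an approximate
unit. -/
lemma IsKMSWeight.star_mem_leftKernel (h : IsKMSWeight ψ γ β) (hβ : β ≠ 0) {a : A}
    (ha : a ∈ ψ.leftKernel) : star a ∈ ψ.leftKernel := by
  have hN : ∀ e ∈ ψ.N, star a * e ∈ ψ.leftKernel := fun e he => by
    have := h.star_mem_leftKernel_of_mem_N hβ (h.proper.mul_mem_leftKernel ha (star e))
      (by rw [star_mul, star_star]; exact mul_mem_N he _)
    rwa [star_mul, star_star] at this
  have hA : ∀ e : A, star a * e ∈ ψ.leftKernel := by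
    have hcl : IsClosed {e : A | star a * e ∈ ψ.leftKernel} :=
      h.proper.isClosed_leftKernel.preimage (by fun_prop)
    exact fun e => closure_minimal hN hcl (h.proper.dense_N e)
  have hu := CStarAlgebra.increasingApproximateUnit A
  have := hu.toIsApproximateUnit.neBot
  exact h.proper.isClosed_leftKernel.mem_of_tendsto
    (hu.toIsApproximateUnit.tendsto_mul_left (star a)) (Filter.Eventually.of_forall hA)

/-- The left kernel of a KMS weight as a two-sided ideal. -/
def IsKMSWeight.kernelIdeal (h : IsKMSWeight ψ γ β) (hβ : β ≠ 0) : TwoSidedIdeal A :=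
  TwoSidedIdeal.mk' ψ.leftKernel h.proper.zero_mem_leftKernel
    (fun ha hb => h.proper.add_mem_leftKernel ha hb)
    (fun {a} ha => by simpa [leftKernel] using ha)
    (fun {b a} ha => h.proper.mul_mem_leftKernel ha b)
    -- Right absorption comes from `ab = (b⋆a⋆)⋆`.
    (fun {a b} ha => by
      have := h.star_mem_leftKernel hβ
        (h.proper.mul_mem_leftKernel (h.star_mem_leftKernel hβ ha) (star b))
      rwa [star_mul, star_star, star_star] at this)

lemma IsKMSWeight.coe_kernelIdeal (h : IsKMSWeight ψ γ β) (hβ : β ≠ 0) :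
    (h.kernelIdeal hβ : Set A) = ψ.leftKernel := by
  simp [kernelIdeal]

/-- A KMS weight on a simple C⋆-algebra has trivial left kernel. -/
lemma IsKMSWeight.eq_zero_of_mem_leftKernel (h : IsKMSWeight ψ γ β) (hβ : β ≠ 0)
    (hA : IsSimpleCStarAlgebra A) {a : A} (ha : a ∈ ψ.leftKernel) : a = 0 := by
  have hcoe := h.coe_kernelIdeal hβ
  rcases hA.eq_bot_or_eq_top (h.kernelIdeal hβ)
    (by rw [hcoe]; exact h.proper.isClosed_leftKernel) with h0 | h1
  · rw [h0] at hcoe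
    rw [← hcoe] at ha
    simpa using ha
  · exfalso
    obtain ⟨p, hp⟩ := h.proper.ne_zero
    apply hp
    have hs : star (CFC.sqrt (p : A)) * CFC.sqrt (p : A) = p := by
      rw [(IsSelfAdjoint.of_nonneg (CFC.sqrt_nonneg (p : A))).star_eq]
      exact CFC.sqrt_mul_sqrt_self (p : A) p.2
    have hm : CFC.sqrt (p : A) ∈ ψ.leftKernel := by
      rw [← hcoe, h1]; simp
    have : (⟨star (CFC.sqrt (p : A)) * CFC.sqrt (p : A), star_mul_self_nonneg _⟩ :
        {a : A // 0 ≤ a}) = p := Subtype.ext hs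
    rw [← this]
    exact hm

lemma IsKMSWeight.isFaithful (h : IsKMSWeight ψ γ β) (hβ : β ≠ 0)
    (hA : IsSimpleCStarAlgebra A) : ψ.IsFaithful := by
  intro p hp
  have hs : star (CFC.sqrt (p : A)) * CFC.sqrt (p : A) = p := by
    rw [(IsSelfAdjoint.of_nonneg (CFC.sqrt_nonneg (p : A))).star_eq]
    exact CFC.sqrt_mul_sqrt_self (p : A) p.2
  have hm : CFC.sqrt (p : A) ∈ ψ.leftKernel := by
    have : (⟨star (CFC.sqrt (p : A)) * CFC.sqrt (p : A), star_mul_self_nonneg _⟩ :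
        {a : A // 0 ≤ a}) = p := Subtype.ext hs
    rw [← this] at hp
    exact hp
  rw [← hs, h.eq_zero_of_mem_leftKernel hβ hA hm, mul_zero]

/-! ### Weights invariant under a conditional expectation -/

lemma Weight.IsInvariant.rep (h : ψ.IsInvariant γ) (t : ℝ) {x : A} {z : ℂ} (hx : ψ.Rep x z) :
    ψ.Rep (γ t x) z := by
  have hfin : ∀ {p : A}, ψ.FiniteAt p → ψ.FiniteAt (γ t p) := fun {p} hp =>
    ⟨map_nonneg_of_starAlgEquiv (γ t) hp.1, by rw [h t ⟨p, hp.1⟩]; exact hp.2⟩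
  have hval : ∀ {p : A}, ψ.FiniteAt p → ψ.realVal (γ t p) = ψ.realVal p := fun {p} hp => by
    rw [realVal, realVal, dif_pos hp.1, dif_pos (hfin hp).1, h t ⟨p, hp.1⟩]
  obtain ⟨p, q, r, s, hp, hq, hr, hs, rfl, rfl⟩ := hx
  refine ⟨γ t p, γ t q, γ t r, γ t s, hfin hp, hfin hq, hfin hr, hfin hs, ?_, ?_⟩
  · simp only [_root_.map_add, _root_.map_smul, map_sub]
  · rw [hval hp, hval hq, hval hr, hval hs]

lemma OneParameterGroup.apply_neg_apply {B : Type*} [NonUnitalCStarAlgebra B]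
    (γ : OneParameterGroup B) (t : ℝ) (a : B) :
    γ t (γ (-t) a) = a := by
  rw [← γ.map_add', add_neg_cancel, γ.map_zero']

section Expectation

variable {D : NonUnitalStarSubalgebra ℂ A} {P : A →ₗ[ℂ] D}

lemma IsConditionalExpectation.finiteAt (hP : IsConditionalExpectation D P)
    (hψP : ∀ a : {a : A // 0 ≤ a}, ψ ⟨P a, hP.nonneg a a.2⟩ = ψ a) {p : A}
    (hp : ψ.FiniteAt p) : ψ.FiniteAt (P p : A) :=
  ⟨hP.nonneg p hp.1, by rw [hψP ⟨p, hp.1⟩]; exact hp.2⟩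

lemma IsConditionalExpectation.realVal_eq (hP : IsConditionalExpectation D P)
    (hψP : ∀ a : {a : A // 0 ≤ a}, ψ ⟨P a, hP.nonneg a a.2⟩ = ψ a) {p : A}
    (hp : 0 ≤ p) : ψ.realVal (P p : A) = ψ.realVal p := by
  rw [realVal, realVal, dif_pos hp, dif_pos (hP.nonneg p hp), hψP ⟨p, hp⟩]

/-- `P` preserves positivity and weight of each piece of a decomposition, so invariance under `P`
passes from `A₊` to the linear extension. -/
lemma IsConditionalExpectation.rep (hP : IsConditionalExpectation D P)
    (hψP : ∀ a : {a : A // 0 ≤ a}, ψ ⟨P a, hP.nonneg a a.2⟩ = ψ a) {x : A} {z : ℂ}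
    (h : ψ.Rep x z) : ψ.Rep (P x : A) z := by
  obtain ⟨p, q, r, s, hp, hq, hr, hs, rfl, rfl⟩ := h
  refine ⟨P p, P q, P r, P s, hP.finiteAt hψP hp, hP.finiteAt hψP hq, hP.finiteAt hψP hr,
    hP.finiteAt hψP hs, by simp, ?_⟩
  rw [hP.realVal_eq hψP hp.1, hP.realVal_eq hψP hq.1, hP.realVal_eq hψP hr.1,
    hP.realVal_eq hψP hs.1]

/-- The weight takes the same value on two elements with the same conditional expectation. -/
lemma IsConditionalExpectation.linExt_eq (hP : IsConditionalExpectation D P)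
    (hψP : ∀ a : {a : A // 0 ≤ a}, ψ ⟨P a, hP.nonneg a a.2⟩ = ψ a) (hψ : ψ.IsProper) {x y : A}
    (hx : x ∈ ψ.M) (hy : y ∈ ψ.M) (h : P x = P y) :
    ψ.linExt ⟨x, hx⟩ = ψ.linExt ⟨y, hy⟩ := by
  have h1 := hP.rep hψP (hψ.rep_linExt hx)
  have h2 := hP.rep hψP (hψ.rep_linExt hy)
  rw [h] at h1
  exact h1.unique h2

/-- Elements of `D` of finite weight are fixed by the one-parameter group. -/
lemma IsKMSWeight.map_eq_self_of_mem_N (h : IsKMSWeight ψ γ β) (hβ : β ≠ 0)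
    (hA : IsSimpleCStarAlgebra A) (hP : IsConditionalExpectation D P)
    (hψP : ∀ a : {a : A // 0 ≤ a}, ψ ⟨P a, hP.nonneg a a.2⟩ = ψ a)
    (hDcomm : ∀ x ∈ D, ∀ y ∈ D, x * y = y * x) {d : A} (hd : d ∈ D) (hdN : d ∈ ψ.N) (t : ℝ) :
    γ t d = d := by
  have hdN' : star d ∈ ψ.N := by
    have e : (⟨star (star d) * star d, star_mul_self_nonneg _⟩ : {a : A // 0 ≤ a})
        = ⟨star d * d, star_mul_self_nonneg d⟩ :=
      Subtype.ext (by simpa only [star_star] using hDcomm d hd (star d) (star_mem hd))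
    change ψ _ < ∞
    rw [e]
    exact hdN
  have hconst : ∀ (b : A) (hb : b ∈ ψ.N) (hb' : star b ∈ ψ.N) (s : ℝ),
      ψ.linExt ⟨d * γ s b, h.invariant.mul_map_mem_M s hdN' hb⟩ =
        ψ.linExt ⟨d * b, mul_mem_M hdN' hb⟩ := by
    intro b hb hb' s
    obtain ⟨F, hc, hbd, hdf, hF⟩ := h.kms d b hdN hdN' hb hb'
    -- The boundary values at `r` agree because `d γ_r(b)` and `γ_r(b) d` have the same image `d
    -- P(γ_r(b)) = P(γ_r(b)) d`.
    have h1 := strip_eq_of_boundary_values_eq hβ hc hbd hdf (fun r => by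
      rw [(hF r).1, (hF r).2]
      refine hP.linExt_eq hψP h.proper _ _ ?_
      have e1 := hP.mul_left ⟨d, hd⟩ (γ r b)
      have e2 := hP.mul_right (γ r b) ⟨d, hd⟩
      simp only at e1 e2
      rw [e1, e2]
      exact Subtype.ext (hDcomm _ hd _ (P (γ r b)).2)) s
    have h2 := (hF 0).1
    rw [Complex.ofReal_zero] at h2
    rw [(hF s).1, h2] at h1
    simpa only [γ.map_zero'] using h1
  set e := γ t d - d with he
  have hγd := h.invariant.map_mem_N t hdN
  have hγd' : star (γ t d) ∈ ψ.N := by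
    rw [← map_star]; exact h.invariant.map_mem_N t hdN'
  have heN : e ∈ ψ.N := by
    simpa [he, sub_eq_add_neg] using add_mem_N hγd (smul_mem_N hdN (-1))
  have heN' : star e ∈ ψ.N := by
    simpa [he, sub_eq_add_neg] using add_mem_N hγd' (smul_mem_N hdN' (-1))
  -- Chosen so that `γ t b = e⋆`: then `hconst` and invariance give `ψ(d e⋆) = ψ(d b) = ψ(γ_t(d)
  -- e⋆)`, that is `ψ(e e⋆) = 0`.
  set b := γ (-t) (star e) with hb
  have hbN : b ∈ ψ.N := h.invariant.map_mem_N (-t) heN'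
  have hbN' : star b ∈ ψ.N := by
    rw [hb, ← map_star, star_star]; exact h.invariant.map_mem_N (-t) heN
  have hγb : γ t b = star e := γ.apply_neg_apply t _
  have h1 := hconst b hbN hbN' t
  simp only [hγb] at h1
  have h2 : ψ.linExt ⟨γ t d * star e, mul_mem_M hγd' heN'⟩ =
      ψ.linExt ⟨d * b, mul_mem_M hdN' hbN⟩ := by
    refine h.proper.linExt_eq_of_rep _ ?_
    have := h.invariant.rep t (h.proper.rep_linExt (mul_mem_M hdN' hbN))
    rwa [map_mul, hγb] at this
  have h3 : star (star e) * star e ∈ ψ.M := mul_mem_M (by rwa [star_star]) heN'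
  have h4 : ψ.linExt ⟨star (star e) * star e, h3⟩ = 0 := by
    have : (⟨star (star e) * star e, h3⟩ : ψ.M) =
        ⟨γ t d * star e, mul_mem_M hγd' heN'⟩ - ⟨d * star e, mul_mem_M hdN' heN'⟩ :=
      Subtype.ext (by
        change star (star e) * star e = γ t d * star e - d * star e
        rw [star_star, ← sub_mul])
    rw [this, map_sub, h1, h2, sub_self]
  have h5 := h.eq_zero_of_mem_leftKernel hβ hA
    ((h.proper.linExt_star_mul_self_eq_zero_iff h3).1 h4)
  exact sub_eq_zero.1 (star_eq_zero.1 h5)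

/-- The one-parameter group of a KMS weight that factors through a conditional expectation onto an
abelian subalgebra fixes the subalgebra pointwise. -/
lemma IsKMSWeight.map_eq_self (h : IsKMSWeight ψ γ β) (hβ : β ≠ 0)
    (hA : IsSimpleCStarAlgebra A) (hP : IsConditionalExpectation D P)
    (hψP : ∀ a : {a : A // 0 ≤ a}, ψ ⟨P a, hP.nonneg a a.2⟩ = ψ a)
    (hDcomm : ∀ x ∈ D, ∀ y ∈ D, x * y = y * x) {d : A} (hd : d ∈ D) (t : ℝ) :
    γ t d = d := by
  have hPc : Continuous P :=
    AddMonoidHomClass.continuous_of_bound P 1 fun a => by simpa using hP.norm_le a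
  have hPc' : Continuous fun x : A => (P x : A) := continuous_subtype_val.comp hPc
  have hγc : Continuous (γ t) := (StarAlgEquiv.isometry (γ t)).continuous
  -- Working with `P x` for `x` in `A` needs only density of finite-weight combinations in `A`, not
  -- in `D`; taking `x = d` at the end recovers `d = P d`.
  have hcl : IsClosed {x : A | γ t (P x) = P x} := isClosed_eq (hγc.comp hPc') hPc'
  have hS : (Submodule.span ℂ {p | ψ.FiniteAt p} : Set A) ⊆ {x : A | γ t (P x) = P x} := by
    intro x hx
    change γ t (P x) = P x
    induction hx using Submodule.span_induction with
    | mem x hx =>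
      exact h.map_eq_self_of_mem_N hβ hA hP hψP hDcomm (P x).2 (hP.finiteAt hψP hx).mem_N t
    | zero => simp
    | add x y _ _ hx hy => simp [hx, hy]
    | smul c x _ hx => simp [hx]
  have := closure_minimal hS hcl (h.proper.dense_span_finiteAt d)
  change γ t (P d) = P d at this
  rwa [show P d = ⟨d, hd⟩ from hP.apply_coe ⟨d, hd⟩] at this

end Expectation

end KMS

theorem mainTheorem6 {A : Type*} [NonUnitalCStarAlgebra A] [PartialOrder A] [StarOrderedRing A]
    (hA : KMS.IsSimpleCStarAlgebra A) (γ : KMS.OneParameterGroup A)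
    (D : NonUnitalStarSubalgebra ℂ A) (hD : IsClosed (D : Set A))
    (hDcomm : ∀ x ∈ D, ∀ y ∈ D, x * y = y * x)
    (P : A →ₗ[ℂ] D) (hP : KMS.IsConditionalExpectation D P)
    (β : ℝ) (hβ : β ≠ 0) (ω : KMS.Weight A) (hω : KMS.IsKMSWeight ω γ β)
    (hωP : ∀ a : {a : A // 0 ≤ a}, ω ⟨P a, hP.nonneg a a.2⟩ = ω a) :
    ω.IsFaithful ∧ ∀ (t : ℝ), ∀ d ∈ D, γ t d = d := by
  exact ⟨hω.isFaithful hβ hA, fun t _ hd => hω.map_eq_self hβ hA hP hωP hDcomm hd t⟩
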